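/- Let $n,m\ge 0$ be integers. Consider the channel $\mathbf y=\mathbf H\mathbf x+\mathbf z$ with input $\mathbf x\in\mathbb C^m$, random channel matrix $\mathbf H\in\mathbb C^{n\times m}$ and random noise $\mathbf z\in\mathbb C^n$, where $\mathbf x,\mathbf H,\mathbf z$ are independent. The distributions of $\mathbf H$ and $\mathbf z$ are fixed; they may be arbitrary Borel probability distributions, subject to the assumption on $\mathbf H$ below. A random vector $\mathbf v\in\mathbb C^k$ (or its distribution) is called circular if $\mathbf v$ and $e^{j2\pi\theta}\mathbf v$ have the same distribution for every $\theta\in[0,1)$. The circular analog of $\mathbf v$ is $e^{j2\pi\psi}\mathbf v$, where $\psi$ is uniformly distributed on $[0,1)$ and independent of $\mathbf v$. A set $\mathcal I$ of probability distributions on $\mathbb C^m$ (the admissible input distributions) is called circular-closed if, for each random vector $\mathbf x$ whose distribution is in $\mathcal I$, the distribution of the circular analog of $\mathbf x$ is also in $\mathcal I$. The mutual information $I(\mathbf x;\mathbf y)\in[0,\infty]$ is the Kullback–Leibler divergence of the joint distribution of $(\mathbf x,\mathbf y)$ from the product of its marginals. The noncoherent capacity is $$C=\sup_{\mathbf x\in\mathcal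 I} I(\mathbf x;\mathbf y)\in[0,\infty],$$ where $\mathbf x\in\mathcal I$ means that the distribution of $\mathbf x$ is in $\mathcal I$. An input $\mathbf x\in\mathcal I$ is said to achieve the noncoherent capacity if $I(\mathbf x;\mathbf y)=C$. Suppose that the $nm$-dimensional random vector obtained by stacking the entries of $\mathbf H$ in some order is circular (the noise $\mathbf z$ need not be circular), that $\mathcal I$ is circular-closed, and that the noncoherent capacity is achieved by some (not necessarily circular) $\mathbf x'\in\mathcal I$. Then there exists a circular random vector $\mathbf x\in\mathcal I$ that achieves the noncoherent capacity. -/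

import Mathlib

open MeasureTheory

open scoped ENNReal

/-- The phase rotation `v ↦ e^{j 2π θ} v` of a complex vector. -/
noncomputable def phaseRotate {ι : Type*} (θ : ℝ) (v : ι → ℂ) : ι → ℂ :=
  Complex.exp (2 * Real.pi * θ * Complex.I) • v

theorem measurable_phaseRotate {ι : Type*} :
    Measurable (fun p : ℝ × (ι → ℂ) => phaseRotate p.1 p.2) := by
  refine measurable_pi_lambda _ fun i => ?_
  have h : Measurable fun p : ℝ × (ι → ℂ) =>
      Complex.exp (2 * Real.pi * p.1 * Complex.I) := by fun_prop
  exact h.mul ((measurable_pi_apply i).comp measurable_snd)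

/-- A distribution on `ℂᵏ` is circular (i.e. is the law of a circular random vector) if it is
the distribution of `e^{j 2π θ} x` for every `θ ∈ [0, 1)`, where `x` is distributed as `P`. -/
def IsCircular {k : ℕ} (P : Measure (Fin k → ℂ)) : Prop :=
  ∀ θ ∈ Set.Ico (0 : ℝ) 1, P.map (phaseRotate θ) = P

/-- The uniform distribution on `[0, 1)`. -/
noncomputable def uniformPhase : Measure ℝ := volume.restrict (Set.Ico (0 : ℝ) 1)

instance isProbabilityMeasure_uniformPhase : IsProbabilityMeasure uniformPhase :=
  ⟨by simp [uniformPhase]⟩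

/-- The law of the circular analog `e^{j 2π ψ} x` of a random vector `x` with law `P`, where `ψ`
is uniformly distributed on `[0, 1)` and independent of `x`. -/
noncomputable def circularAnalog {k : ℕ} (P : ProbabilityMeasure (Fin k → ℂ)) :
    ProbabilityMeasure (Fin k → ℂ) :=
  ⟨(uniformPhase.prod (P : Measure (Fin k → ℂ))).map
      (fun p : ℝ × (Fin k → ℂ) => phaseRotate p.1 p.2),
    Measure.isProbabilityMeasure_map measurable_phaseRotate.aemeasurable⟩

/-- A set of distributions is circular-closed if it is closed under forming the circular analog. -/
def IsCircularClosed {k : ℕ} (S : Set (ProbabilityMeasure (Fin k → ℂ))) : Prop :=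
  ∀ P ∈ S, circularAnalog P ∈ S

/-- The mutual information `I(X; Y)` (in nats, with values in `[0, ∞]`) of two random elements:
the Kullback-Leibler divergence of the joint law from the product of the marginal laws. -/
noncomputable def mutualInfo {Ω E F : Type*} [MeasurableSpace Ω] [MeasurableSpace E]
    [MeasurableSpace F] (μ : Measure Ω) (X : Ω → E) (Y : Ω → F) : ℝ≥0∞ :=
  InformationTheory.klDiv (μ.map (fun ω => (X ω, Y ω))) ((μ.map X).prod (μ.map Y))

/-- The Borel σ-algebra on complex matrices, i.e. the product σ-algebra of the entries. -/
noncomputable instance matrixMeasurableSpace {n m : ℕ} : MeasurableSpace (Matrix (Fin n) (Fin m) ℂ) :=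
  inferInstanceAs (MeasurableSpace (Fin n → Fin m → ℂ))

/-- The vector in `ℂ^{nm}` obtained by stacking the entries of an `n × m` matrix in the order
prescribed by the bijection `e`. -/
def stackMatrix {n m : ℕ} (e : Fin (n * m) ≃ Fin n × Fin m) (A : Matrix (Fin n) (Fin m) ℂ) :
    Fin (n * m) → ℂ :=
  fun k => A (e k).1 (e k).2

/-- `I(x; y)` for the channel `y = H x + z`, where `x`, `H`, `z` are independent with laws
`P`, `lawH`, `lawZ`; they are realized as the coordinates `(ω.1, ω.2.1, ω.2.2)` on the product
space. The receiver observes `y` only. -/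
noncomputable def channelMutualInfo {n m : ℕ}
    (lawH : ProbabilityMeasure (Matrix (Fin n) (Fin m) ℂ))
    (lawZ : ProbabilityMeasure (Fin n → ℂ)) (P : ProbabilityMeasure (Fin m → ℂ)) : ℝ≥0∞ :=
  mutualInfo
    ((P : Measure (Fin m → ℂ)).prod
      ((lawH : Measure (Matrix (Fin n) (Fin m) ℂ)).prod (lawZ : Measure (Fin n → ℂ))))
    (fun ω => ω.1)
    (fun ω => ω.2.1.mulVec ω.1 + ω.2.2)

/-- The noncoherent capacity of `y = H x + z` over a set `S` of admissible input distributions. -/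
noncomputable def noncoherentCapacity {n m : ℕ}
    (lawH : ProbabilityMeasure (Matrix (Fin n) (Fin m) ℂ))
    (lawZ : ProbabilityMeasure (Fin n → ℂ)) (S : Set (ProbabilityMeasure (Fin m → ℂ))) : ℝ≥0∞ :=
  ⨆ P ∈ S, channelMutualInfo lawH lawZ P

/-- The admissible input distribution `P` is capacity-achieving. -/
def AchievesNoncoherentCapacity {n m : ℕ}
    (lawH : ProbabilityMeasure (Matrix (Fin n) (Fin m) ℂ))
    (lawZ : ProbabilityMeasure (Fin n → ℂ)) (S : Set (ProbabilityMeasure (Fin m → ℂ)))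
    (P : ProbabilityMeasure (Fin m → ℂ)) : Prop :=
  P ∈ S ∧ channelMutualInfo lawH lawZ P = noncoherentCapacity lawH lawZ S

/-! Since $H(cx)=(cH)x$ and $cH\sim H$ for every phase $c$, the output law given the input is
unchanged when the input is rotated (`channelKernel_phaseRotate`). Couple $x$ with its circular
analog $\tilde x$. The channel cannot tell the two apart, so feeding $\tilde x$ to the channel and
drawing $x$ from its conditional law given $\tilde x$, independently of $y$, yields the correct
joint law of $(x,y)$. Thus $\tilde x\to x$ is local processing of the input side, and data
processing for the divergence gives $I(x;y)\le I(\tilde x;y)$ (`klDiv_compProd_prod_snd_le`).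
Applied to an optimal $x$, this makes $\tilde x$ optimal. -/

open ProbabilityTheory InformationTheory

/-! ### Data processing through a reverse channel -/

section ReverseChannel

variable {X Y : Type*} [MeasurableSpace X] [MeasurableSpace Y]

/-- The exceptional null set may depend on `t`: output laws are compared one event at a time. -/
lemma comp_fst_eq_comp_snd (J : Measure (X × X)) (K : Kernel X Y)
    (h : ∀ t, MeasurableSet t → ∀ᵐ p ∂J, K p.1 t = K p.2 t) : K ∘ₘ J.fst = K ∘ₘ J.snd := by
  ext s hs
  have hK := K.measurable_coe hs
  rw [Measure.bind_apply hs K.aemeasurable, Measure.bind_apply hs K.aemeasurable, Measure.fst,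
    Measure.snd, lintegral_map hK measurable_fst, lintegral_map hK measurable_snd]
  exact lintegral_congr_ae (h s hs)

/-- If the channel `K` does not distinguish the two coordinates of `J`, the joint law of input and
output for the second coordinate is obtained from the one for the first coordinate by applying the
reverse channel `J.condKernel` to the input. -/
lemma parallelComp_condKernel_comp_compProd [StandardBorelSpace X] [Nonempty X]
    (J : Measure (X × X)) [IsFiniteMeasure J] (K : Kernel X Y) [IsMarkovKernel K]
    (h : ∀ t, MeasurableSet t → ∀ᵐ p ∂J, K p.1 t = K p.2 t) :
    (J.condKernel ∥ₖ Kernel.id) ∘ₘ (J.fst ⊗ₘ K) = J.snd ⊗ₘ K := by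
  refine Measure.ext_prod fun {s t} hs ht => ?_
  have hK := K.measurable_coe ht
  have hY := (Kernel.id : Kernel Y Y).measurable_coe ht
  have hR := J.condKernel.measurable_coe hs
  have hL : ((J.condKernel ∥ₖ (Kernel.id : Kernel Y Y)) ∘ₘ (J.fst ⊗ₘ K)) (s ×ˢ t)
      = ∫⁻ x, J.condKernel x s * K x t ∂J.fst := by
    rw [Measure.bind_apply (hs.prod ht) (Kernel.aemeasurable _)]
    simp_rw [Kernel.parallelComp_apply_prod]
    have hmeas : Measurable fun p : X × Y => J.condKernel p.1 s * Kernel.id p.2 t :=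
      (hR.comp measurable_fst).mul (hY.comp measurable_snd)
    rw [Measure.lintegral_compProd hmeas]
    refine lintegral_congr fun x => ?_
    dsimp only
    rw [lintegral_const_mul _ hY]
    simp [Kernel.id_apply, Measure.dirac_apply' _ ht, lintegral_indicator_one ht]
  -- Undo the disintegration of `J`.
  have hM : ∫⁻ x, J.condKernel x s * K x t ∂J.fst
      = ∫⁻ p, s.indicator 1 p.2 * K p.1 t ∂J := by
    have hmeas : Measurable fun p : X × X => s.indicator (1 : X → ℝ≥0∞) p.2 * K p.1 t :=
      ((measurable_one.indicator hs).comp measurable_snd).mul (hK.comp measurable_fst)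
    conv_rhs => rw [← J.disintegrate J.condKernel]
    rw [Measure.lintegral_compProd hmeas]
    refine lintegral_congr fun x => ?_
    dsimp only
    rw [lintegral_mul_const _ (measurable_one.indicator hs), lintegral_indicator_one hs]
  rw [hL, hM, Measure.compProd_apply_prod hs ht, Measure.snd,
    setLIntegral_map hs hK measurable_snd, ← lintegral_indicator (measurable_snd hs)]
  -- Only here is `K p.1 t` exchanged for `K p.2 t`.
  refine lintegral_congr_ae ((h t ht).mono fun p hp => ?_)
  by_cases hps : p.2 ∈ s <;> simp [hps, hp]

/-- The same Markov kernel carries both measures on the right to those on the left, so data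
processing applies. -/
lemma klDiv_compProd_snd_le [StandardBorelSpace X] [Nonempty X]
    (J : Measure (X × X)) [IsFiniteMeasure J] (K L : Kernel X Y) [IsMarkovKernel K]
    [IsMarkovKernel L] (hK : ∀ t, MeasurableSet t → ∀ᵐ p ∂J, K p.1 t = K p.2 t) 
    (hL : ∀ t, MeasurableSet t → ∀ᵐ p ∂J, L p.1 t = L p.2 t) :
    klDiv (J.snd ⊗ₘ K) (J.snd ⊗ₘ L) ≤ klDiv (J.fst ⊗ₘ K) (J.fst ⊗ₘ L) := by
  rw [← parallelComp_condKernel_comp_compProd J K hK,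
    ← parallelComp_condKernel_comp_compProd J L hL]
  exact klDiv_comp_right_le _ _ _

/-- The information `I(x; y)` between an input with law `J.snd` and the output of `K` is at most
that for an input with law `J.fst`, if `K` does not distinguish the coordinates of `J`. -/
lemma klDiv_compProd_prod_snd_le [StandardBorelSpace X] [Nonempty X]
    (J : Measure (X × X)) [IsProbabilityMeasure J] (K : Kernel X Y) [IsMarkovKernel K]
    (hK : ∀ t, MeasurableSet t → ∀ᵐ p ∂J, K p.1 t = K p.2 t) :
    klDiv (J.snd ⊗ₘ K) (J.snd.prod (K ∘ₘ J.snd)) ≤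
      klDiv (J.fst ⊗ₘ K) (J.fst.prod (K ∘ₘ J.fst)) := by
  -- Both inputs have the same output law, so each product of marginals is a composition with one
  -- and the same constant kernel.
  rw [comp_fst_eq_comp_snd J K hK, ← Measure.compProd_const, ← Measure.compProd_const]
  exact klDiv_compProd_snd_le J K (Kernel.const X (K ∘ₘ J.snd)) hK (by simp)

end ReverseChannel

/-! ### Uniform phases and the circular analog -/

section PhaseRotation

variable {ι : Type*}

lemma phaseRotate_add (a b : ℝ) (v : ι → ℂ) :
    phaseRotate (a + b) v = phaseRotate a (phaseRotate b v) := by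
  simp only [phaseRotate, smul_smul, ← Complex.exp_add]
  congr 2
  push_cast
  ring

lemma phaseRotate_one (v : ι → ℂ) : phaseRotate 1 v = v := by
  simp [phaseRotate]

lemma measurable_phaseRotate_right (θ : ℝ) : Measurable fun v : ι → ℂ => phaseRotate θ v :=
  Measurable.of_uncurry_left (f := phaseRotate) measurable_phaseRotate

lemma lintegral_uniformPhase_add {g : ℝ → ℝ≥0∞} (hg : Function.Periodic g 1) (a : ℝ) :
    ∫⁻ θ, g (a + θ) ∂uniformPhase = ∫⁻ θ, g θ ∂uniformPhase := by
  have hshift : ∫⁻ θ in Set.Ioc (0 : ℝ) 1, g (a + θ) = ∫⁻ θ in Set.Ioc a (a + 1), g θ := by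
    have := (measurePreserving_add_left volume a).setLIntegral_comp_preimage_emb
      (measurableEmbedding_addLeft a) g (Set.Ioc a (a + 1))
    rw [← this]
    simp
  have hinv : ∀ (γ : AddSubgroup.zmultiples (1 : ℝ)) (x : ℝ), g (γ +ᵥ x) = g x := by
    rintro ⟨_, k, rfl⟩ x
    have := hg.zsmul k x
    rwa [add_comm] at this
  simp only [uniformPhase, restrict_Ico_eq_restrict_Ioc]
  rw [hshift]
  -- Both intervals are fundamental domains for the integer translations, which leave `g` invariant.
  have := (isAddFundamentalDomain_Ioc one_pos a).setLIntegral_eq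
    (isAddFundamentalDomain_Ioc one_pos 0) g hinv
  simpa using this

/-- Given `v`, adding a constant to a uniform phase leaves it uniform modulo 1. -/
lemma isCircular_circularAnalog {k : ℕ} (P : ProbabilityMeasure (Fin k → ℂ)) :
    IsCircular (circularAnalog P : Measure (Fin k → ℂ)) := by
  intro a _
  ext s hs
  have key (b : ℝ) : (circularAnalog P : Measure (Fin k → ℂ)) (phaseRotate b ⁻¹' s)
      = ∫⁻ v, ∫⁻ θ, s.indicator 1 (phaseRotate (b + θ) v) ∂uniformPhase ∂(P : Measure _) := by
    have hb := measurable_phaseRotate_right (ι := Fin k) b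
    have hmeas : Measurable fun p : ℝ × (Fin k → ℂ) =>
        (phaseRotate b ⁻¹' s).indicator (1 : (Fin k → ℂ) → ℝ≥0∞) (phaseRotate p.1 p.2) :=
      (measurable_one.indicator (hb hs)).comp measurable_phaseRotate
    rw [← lintegral_indicator_one (hb hs)]
    change ∫⁻ v, _ ∂((uniformPhase.prod (P : Measure (Fin k → ℂ))).map _) = _
    rw [lintegral_map (measurable_one.indicator (hb hs)) measurable_phaseRotate,
      lintegral_prod_symm' _ hmeas]
    refine lintegral_congr fun v => lintegral_congr fun θ => ?_
    rw [phaseRotate_add]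
    rfl
  have hper (v : Fin k → ℂ) :
      Function.Periodic (fun θ => s.indicator (1 : (Fin k → ℂ) → ℝ≥0∞) (phaseRotate θ v)) 1 :=
    fun θ => by simp only [phaseRotate_add, phaseRotate_one]
  have h0 : phaseRotate 0 ⁻¹' s = s := by ext v; simp [phaseRotate]
  rw [Measure.map_apply (measurable_phaseRotate_right a) hs, key a]
  conv_rhs => rw [← h0, key 0]
  refine lintegral_congr fun v => ?_
  rw [lintegral_uniformPhase_add (hper v) a, lintegral_uniformPhase_add (hper v) 0]

/-- The joint law of the circular analog of `x` and `x` itself, where `x` has law `P`. -/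
noncomputable def circularCoupling {k : ℕ} (P : ProbabilityMeasure (Fin k → ℂ)) :
    Measure ((Fin k → ℂ) × (Fin k → ℂ)) :=
  (uniformPhase.prod (P : Measure (Fin k → ℂ))).map fun p => (phaseRotate p.1 p.2, p.2)

lemma measurable_phaseRotate_prodMk_snd :
    Measurable fun p : ℝ × (ι → ℂ) => (phaseRotate p.1 p.2, p.2) :=
  measurable_phaseRotate.prodMk measurable_snd

instance isProbabilityMeasure_circularCoupling {k : ℕ} (P : ProbabilityMeasure (Fin k → ℂ)) :
    IsProbabilityMeasure (circularCoupling P) :=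
  Measure.isProbabilityMeasure_map measurable_phaseRotate_prodMk_snd.aemeasurable

lemma fst_circularCoupling {k : ℕ} (P : ProbabilityMeasure (Fin k → ℂ)) :
    (circularCoupling P).fst = circularAnalog P := by
  rw [circularCoupling, Measure.fst_map_prodMk measurable_snd]
  rfl

lemma snd_circularCoupling {k : ℕ} (P : ProbabilityMeasure (Fin k → ℂ)) :
    (circularCoupling P).snd = P := by
  rw [circularCoupling, Measure.snd_map_prodMk measurable_phaseRotate]
  exact Measure.snd_prod

end PhaseRotation

/-! ### The channel kernel and its invariance under input rotations -/

section Channel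

variable {n m : ℕ}

lemma measurable_matrix_apply (i : Fin n) (j : Fin m) :
    Measurable fun A : Matrix (Fin n) (Fin m) ℂ => A i j :=
  (measurable_pi_apply j).comp (measurable_pi_apply (X := fun _ : Fin n => Fin m → ℂ) i)

lemma measurable_matrix_of_apply {α : Type*} [MeasurableSpace α]
    {f : α → Matrix (Fin n) (Fin m) ℂ} (hf : ∀ i j, Measurable fun a => f a i j) :
    Measurable f :=
  measurable_pi_lambda (X := fun _ : Fin n => Fin m → ℂ) f fun i =>
    measurable_pi_lambda _ (hf i)

lemma measurable_channel : Measurable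
    fun ω : (Fin m → ℂ) × Matrix (Fin n) (Fin m) ℂ × (Fin n → ℂ) =>
      ω.2.1.mulVec ω.1 + ω.2.2 := by
  refine measurable_pi_lambda _ fun i => ?_
  simp only [Pi.add_apply, Matrix.mulVec, dotProduct]
  refine Measurable.add (Finset.measurable_sum _ fun j _ => Measurable.mul ?_ ?_) ?_
  · exact (measurable_matrix_apply i j).comp (measurable_fst.comp measurable_snd)
  · exact (measurable_pi_apply j).comp measurable_fst
  · exact (measurable_pi_apply i).comp (measurable_snd.comp measurable_snd)

lemma measurable_channel_right (x : Fin m → ℂ) : Measurable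
    fun ω : Matrix (Fin n) (Fin m) ℂ × (Fin n → ℂ) => ω.1.mulVec x + ω.2 :=
  Measurable.of_uncurry_left
    (f := fun (x : Fin m → ℂ) (ω : Matrix (Fin n) (Fin m) ℂ × (Fin n → ℂ)) =>
      ω.1.mulVec x + ω.2) measurable_channel

/-- The conditional law of the output `y = H x + z` given the input `x`. -/
noncomputable def channelKernel (lawH : ProbabilityMeasure (Matrix (Fin n) (Fin m) ℂ))
    (lawZ : ProbabilityMeasure (Fin n → ℂ)) : Kernel (Fin m → ℂ) (Fin n → ℂ) :=
  (Kernel.id ×ₖ Kernel.const _ ((lawH : Measure (Matrix (Fin n) (Fin m) ℂ)).prod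
    (lawZ : Measure (Fin n → ℂ)))).map fun ω => ω.2.1.mulVec ω.1 + ω.2.2

instance isMarkovKernel_channelKernel (lawH : ProbabilityMeasure (Matrix (Fin n) (Fin m) ℂ))
    (lawZ : ProbabilityMeasure (Fin n → ℂ)) : IsMarkovKernel (channelKernel lawH lawZ) :=
  Kernel.IsMarkovKernel.map _ measurable_channel

lemma channelKernel_apply (lawH : ProbabilityMeasure (Matrix (Fin n) (Fin m) ℂ))
    (lawZ : ProbabilityMeasure (Fin n → ℂ)) (x : Fin m → ℂ) :
    channelKernel lawH lawZ x = ((lawH : Measure (Matrix (Fin n) (Fin m) ℂ)).prod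
      (lawZ : Measure (Fin n → ℂ))).map fun ω => ω.1.mulVec x + ω.2 := by
  rw [channelKernel, Kernel.map_apply _ measurable_channel, Kernel.prod_apply, Kernel.id_apply,
    Kernel.const_apply, Measure.dirac_prod, Measure.map_map measurable_channel measurable_prodMk_left]
  rfl

lemma compProd_channelKernel (lawH : ProbabilityMeasure (Matrix (Fin n) (Fin m) ℂ))
    (lawZ : ProbabilityMeasure (Fin n → ℂ)) (P : Measure (Fin m → ℂ)) [SFinite P] :
    P ⊗ₘ channelKernel lawH lawZ =
      (P.prod ((lawH : Measure (Matrix (Fin n) (Fin m) ℂ)).prod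
        (lawZ : Measure (Fin n → ℂ)))).map fun ω => (ω.1, ω.2.1.mulVec ω.1 + ω.2.2) := by
  have hm := measurable_fst.prodMk (measurable_channel (n := n) (m := m))
  ext s hs
  rw [Measure.compProd_apply hs, Measure.map_apply hm hs, Measure.prod_apply (hm hs)]
  refine lintegral_congr fun x => ?_
  rw [channelKernel_apply, Measure.map_apply (measurable_channel_right x)
    (measurable_prodMk_left hs)]
  rfl

lemma channelMutualInfo_eq (lawH : ProbabilityMeasure (Matrix (Fin n) (Fin m) ℂ))
    (lawZ : ProbabilityMeasure (Fin n → ℂ)) (P : ProbabilityMeasure (Fin m → ℂ)) :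
    channelMutualInfo lawH lawZ P =
      klDiv ((P : Measure (Fin m → ℂ)) ⊗ₘ channelKernel lawH lawZ)
        ((P : Measure (Fin m → ℂ)).prod (channelKernel lawH lawZ ∘ₘ (P : Measure (Fin m → ℂ)))) := by
  have hm := measurable_fst.prodMk (measurable_channel (n := n) (m := m))
  rw [channelMutualInfo, mutualInfo, ← Measure.snd_compProd, compProd_channelKernel,
    Measure.snd_map_prodMk measurable_fst]
  congr 2
  exact Measure.fst_prod

lemma measurable_stackMatrix (e : Fin (n * m) ≃ Fin n × Fin m) :
    Measurable (stackMatrix e) :=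
  measurable_pi_lambda _ fun _ => measurable_matrix_apply _ _

/-- Unstacking is a left inverse of stacking and commutes with scalars. -/
lemma map_smul_eq_of_isCircular (e : Fin (n * m) ≃ Fin n × Fin m)
    (lawH : Measure (Matrix (Fin n) (Fin m) ℂ)) (hH : IsCircular (lawH.map (stackMatrix e)))
    {θ : ℝ} (hθ : θ ∈ Set.Ico (0 : ℝ) 1) :
    lawH.map (fun A => Complex.exp (2 * Real.pi * θ * Complex.I) • A) = lawH := by
  let u : (Fin (n * m) → ℂ) → Matrix (Fin n) (Fin m) ℂ := fun v => .of fun i j => v (e.symm (i, j))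
  have hu : Measurable u :=
    measurable_matrix_of_apply fun i j => measurable_pi_apply (e.symm (i, j))
  have hus : u ∘ stackMatrix e = id := by
    ext A i j
    simp [u, stackMatrix]
  have h := congrArg (Measure.map u) (hH θ hθ)
  have hr := measurable_phaseRotate_right (ι := Fin (n * m)) θ
  rw [Measure.map_map hr (measurable_stackMatrix e),
    Measure.map_map hu (hr.comp (measurable_stackMatrix e)),
    Measure.map_map hu (measurable_stackMatrix e), hus, Measure.map_id] at h
  convert h using 2
  ext A i j
  simp [u, stackMatrix, phaseRotate]

/-- The phase moves from the input onto `H` and is absorbed there; the noise is never rotated, so it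
need not be circular. -/
lemma channelKernel_phaseRotate (e : Fin (n * m) ≃ Fin n × Fin m)
    (lawH : ProbabilityMeasure (Matrix (Fin n) (Fin m) ℂ)) (lawZ : ProbabilityMeasure (Fin n → ℂ))
    (hH : IsCircular ((lawH : Measure (Matrix (Fin n) (Fin m) ℂ)).map (stackMatrix e)))
    {θ : ℝ} (hθ : θ ∈ Set.Ico (0 : ℝ) 1) (x : Fin m → ℂ) :
    channelKernel lawH lawZ (phaseRotate θ x) = channelKernel lawH lawZ x := by
  set c := Complex.exp (2 * Real.pi * θ * Complex.I) with hc
  have hsm : Measurable fun A : Matrix (Fin n) (Fin m) ℂ => c • A :=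
    measurable_matrix_of_apply fun i j => (measurable_matrix_apply i j).const_mul c
  rw [channelKernel_apply, channelKernel_apply]
  conv_rhs =>
    rw [← map_smul_eq_of_isCircular e _ hH hθ, ← hc,
      ← Measure.map_id (μ := (lawZ : Measure (Fin n → ℂ))), Measure.map_prod_map _ _ hsm measurable_id,
      Measure.map_map (measurable_channel_right x) (hsm.prodMap measurable_id)]
  congr 1
  ext ω i
  simp [phaseRotate, ← hc, Matrix.mulVec_smul, Matrix.smul_mulVec]

lemma channelMutualInfo_le_circularAnalog (e : Fin (n * m) ≃ Fin n × Fin m)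
    (lawH : ProbabilityMeasure (Matrix (Fin n) (Fin m) ℂ)) (lawZ : ProbabilityMeasure (Fin n → ℂ))
    (hH : IsCircular ((lawH : Measure (Matrix (Fin n) (Fin m) ℂ)).map (stackMatrix e)))
    (P : ProbabilityMeasure (Fin m → ℂ)) :
    channelMutualInfo lawH lawZ P ≤ channelMutualInfo lawH lawZ (circularAnalog P) := by
  have hK (t : Set (Fin n → ℂ)) (ht : MeasurableSet t) : ∀ᵐ p ∂circularCoupling P,
      channelKernel lawH lawZ p.1 t = channelKernel lawH lawZ p.2 t := by
    have hKt := (channelKernel lawH lawZ).measurable_coe ht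
    have hθ : ∀ᵐ θ ∂uniformPhase, θ ∈ Set.Ico (0 : ℝ) 1 := ae_restrict_mem measurableSet_Ico
    have hset : MeasurableSet {p : (Fin m → ℂ) × (Fin m → ℂ) |
        channelKernel lawH lawZ p.1 t = channelKernel lawH lawZ p.2 t} :=
      measurableSet_eq_fun (hKt.comp measurable_fst) (hKt.comp measurable_snd)
    rw [circularCoupling, ae_map_iff measurable_phaseRotate_prodMk_snd.aemeasurable hset]
    filter_upwards [Measure.quasiMeasurePreserving_fst.ae hθ] with p hp
    rw [channelKernel_phaseRotate e lawH lawZ hH hp]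
  -- The analog is the first coordinate of the coupling, so the reverse channel leads from it to the
  -- original input.
  have := klDiv_compProd_prod_snd_le (circularCoupling P) (channelKernel lawH lawZ) hK
  rwa [fst_circularCoupling, snd_circularCoupling, ← channelMutualInfo_eq,
    ← channelMutualInfo_eq] at this

end Channel

theorem mainTheorem8 (n m : ℕ)
    (lawH : ProbabilityMeasure (Matrix (Fin n) (Fin m) ℂ))
    (lawZ : ProbabilityMeasure (Fin n → ℂ))
    (e : Fin (n * m) ≃ Fin n × Fin m)
    (hH : IsCircular ((lawH : Measure (Matrix (Fin n) (Fin m) ℂ)).map (stackMatrix e)))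
    (S : Set (ProbabilityMeasure (Fin m → ℂ)))
    (hS : IsCircularClosed S)
    (hattained : ∃ P' : ProbabilityMeasure (Fin m → ℂ),
      AchievesNoncoherentCapacity lawH lawZ S P') :
    ∃ P : ProbabilityMeasure (Fin m → ℂ),
      IsCircular (P : Measure (Fin m → ℂ)) ∧ AchievesNoncoherentCapacity lawH lawZ S P := by
  obtain ⟨P', hP'S, hP'⟩ := hattained
  refine ⟨circularAnalog P', isCircular_circularAnalog P', hS P' hP'S, le_antisymm ?_ ?_⟩
  · exact le_iSup₂ (f := fun P _ => channelMutualInfo lawH lawZ P) (circularAnalog P') (hS P' hP'S)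
  · rw [← hP']
    exact channelMutualInfo_le_circularAnalog e lawH lawZ hH P'
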